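/- Consider a finite POMDP with world states $\mathcal S$, actions $\mathcal U$, observations $\mathcal Y$, transition probabilities $q(j\mid i,u)$, observation probabilities $\nu(y\mid i)$, and a (possibly stochastic) reward in each state: each time a state $i$ is entered, a reward is drawn from a law depending only on $i$, independently of everything else given $i$; its mean is $r(i)$. A stochastic finite state controller has a finite set $\mathcal G$ of internal states (I-states), I-state transition probabilities $\omega(h\mid\phi,g,y)$ with parameters $\phi\in\mathbb R^{n_\phi}$, and action probabilities $\mu(u\mid\theta,h,y)$ with parameters $\theta\in\mathbb R^{n_\theta}$. At time $t$, with world/I-state pair $(i_t,g_t)$, one draws $y_t\sim\nu(\cdot\mid i_t)$, $g_{t+1}\sim\omega(\cdot\mid\phi,g_t,y_t)$, $u_t\sim\mu(\cdot\mid\theta,g_{t+1},y_t)$, $i_{t+1}\sim q(\cdot\mid i_t,u_t)$, and receives the reward $r_{t+1}$ of $i_{t+1}$. The pairs $(i_t,g_t)$ form a Markov chain with transition matrix $P=P(\theta,\phi)$, $$p(j,h\mid\theta,\phi,i,g)=\sum_{y,u}\nu(y\mid i)\,\omega(h\mid\phi,g,y)\,\mu(u\mid\theta,h,y)\,q(j\mid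 i,u).$$ Assume: 1. for all $\theta,\phi$ the matrix $P(\theta,\phi)$ has a unique stationary distribution $\pi(\theta,\phi)$; 2. the magnitudes of the rewards are uniformly bounded by some $R<\infty$; 3. the partial derivatives $\partial\mu(u\mid\theta,h,y)/\partial\theta_k$ and $\partial\omega(h\mid\phi,g,y)/\partial\phi_l$ exist and are uniformly bounded, over all arguments and parameters; 4. the ratios $|\partial\mu(u\mid\theta,h,y)/\partial\theta_k|/\mu(u\mid\theta,h,y)$ and $|\partial\omega(h\mid\phi,g,y)/\partial\phi_l|/\omega(h\mid\phi,g,y)$ are uniformly bounded, over all arguments and parameters, i.e. $|\partial\mu/\partial\theta_k|\le D\mu$ and $|\partial\omega/\partial\phi_l|\le B\omega$ for finite constants $D,B$. Fix $\theta$, $\phi$ and $\beta\in[0,1)$. The IState-GPOMDP estimate $\Delta_T=[\Delta^\theta_T,\Delta^\phi_T]$ is computed along a run by $z_0=0$, $\Delta_0=0$ and $$z^\phi_{t+1}=\beta z^\phi_t+\frac{\nabla\omega(g_{t+1}\mid\phi,g_t,y_t)}{\omega(g_{t+1}\mid\phi,g_t,y_t)},\qquad z^\theta_{t+1}=\beta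 z^\theta_t+\frac{\nabla\mu(u_t\mid\theta,g_{t+1},y_t)}{\mu(u_t\mid\theta,g_{t+1},y_t)},$$ $$\Delta_{t+1}=\Delta_t+\tfrac1{t+1}\left[r_{t+1}z_{t+1}-\Delta_t\right],\qquad z_t=[z^\theta_t,z^\phi_t].$$ Let $J_\beta(i,g)=\mathbb E\left[\sum_{t=0}^\infty\beta^t r(i_t)\mid i_0=i,\,g_0=g\right]$. Then, for every initial distribution of $(i_0,g_0)$, almost surely $$\lim_{T\to\infty}\Delta_T=\pi'(\nabla P)J_\beta ,$$ that is, for each of the $n_\theta+n_\phi$ parameters, the corresponding component of $\Delta_T$ converges to $\pi'\,(\partial P)\,J_\beta$, with $\partial P$ the entrywise partial derivative of $P$ in that parameter, and $\pi$, $P$, $\partial P$ and $J_\beta$ taken at $(\theta,\phi)$. -/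

import Mathlib

open MeasureTheory ProbabilityTheory Filter Topology Matrix

noncomputable section

namespace IStatePOMDP

/-- A finite partially observable Markov decision process with world states `S`, actions `U` and
observations `Y`. The reward of a state may be stochastic: at each visit to the state `i` a reward
with law `rewardLaw i` is drawn. A deterministic reward `r i` is the case of a Dirac law. -/
structure POMDP (S U Y : Type*) [Fintype S] [Fintype Y] where
  /-- `q i u j` is the probability of moving from `i` to `j` under the action `u`. -/
  q : S → U → S → ℝ
  q_nonneg : ∀ i u j, 0 ≤ q i u j
  q_sum : ∀ i u, ∑ j, q i u j = 1
  /-- `ν i y` is the probability of observing `y` in the state `i`. -/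
  ν : S → Y → ℝ
  ν_nonneg : ∀ i y, 0 ≤ ν i y
  ν_sum : ∀ i, ∑ y, ν i y = 1
  /-- The law of the reward received in the state `i`. -/
  rewardLaw : S → Measure ℝ
  rewardLaw_isProb : ∀ i, IsProbabilityMeasure (rewardLaw i)

/-- A parameterised stochastic finite state controller with internal states `G`. -/
structure Controller (G U Y : Type*) [Fintype G] [Fintype U] (nθ nφ : ℕ) where
  /-- `μ θ h y u` is the probability of the action `u` given the I-state `h` and observation `y`. -/
  μ : (Fin nθ → ℝ) → G → Y → U → ℝ
  μ_nonneg : ∀ θ h y u, 0 ≤ μ θ h y u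
  μ_sum : ∀ θ h y, ∑ u, μ θ h y u = 1
  /-- `ω φ g y h` is the probability of moving from the I-state `g` to the I-state `h` on
  observing `y`. -/
  ω : (Fin nφ → ℝ) → G → Y → G → ℝ
  ω_nonneg : ∀ φ g y h, 0 ≤ ω φ g y h
  ω_sum : ∀ φ g y, ∑ h, ω φ g y h = 1

attribute [instance] POMDP.rewardLaw_isProb

/-- `f` has a partial derivative at `x` in the coordinate `k`. -/
def HasPartialAt {n : ℕ} (f : (Fin n → ℝ) → ℝ) (x : Fin n → ℝ) (k : Fin n) : Prop :=
  DifferentiableAt ℝ (fun s : ℝ => f (Function.update x k s)) (x k)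

/-- The partial derivative `∂f/∂x_k` at `x`. -/
def pderiv {n : ℕ} (f : (Fin n → ℝ) → ℝ) (x : Fin n → ℝ) (k : Fin n) : ℝ :=
  deriv (fun s : ℝ => f (Function.update x k s)) (x k)

variable {S U Y G : Type*} [Fintype S] [Fintype U] [Fintype Y] [Fintype G] {nθ nφ : ℕ}

/-- The mean reward `r(i)` of the state `i`. -/
def POMDP.r (M : POMDP S U Y) (i : S) : ℝ := ∫ x, x ∂(M.rewardLaw i)

/-- The transition matrix `P(θ,φ)` of the world/I-state pairs. -/
def P (M : POMDP S U Y) (C : Controller G U Y nθ nφ) (θ : Fin nθ → ℝ) (φ : Fin nφ → ℝ) :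
    Matrix (S × G) (S × G) ℝ :=
  Matrix.of fun x x' =>
    ∑ y, ∑ u, M.ν x.1 y * C.ω φ x.2 y x'.2 * C.μ θ x'.2 y u * M.q x.1 u x'.1

/-- `∇P`: the matrix of entrywise partial derivatives of `P` for each parameter, the parameters
being those of `θ` (left) together with those of `φ` (right). -/
def gradP (M : POMDP S U Y) (C : Controller G U Y nθ nφ) (θ : Fin nθ → ℝ) (φ : Fin nφ → ℝ) :
    Fin nθ ⊕ Fin nφ → Matrix (S × G) (S × G) ℝ :=
  Sum.elim
    (fun k => Matrix.of fun x x' => pderiv (fun θ' => P M C θ' φ x x') θ k)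
    (fun l => Matrix.of fun x x' => pderiv (fun φ' => P M C θ φ' x x') φ l)

/-- `π` is a stationary distribution of the matrix `A`. -/
def IsStationary {X : Type*} [Fintype X] (A : Matrix X X ℝ) (π : X → ℝ) : Prop :=
  (∀ x, 0 ≤ π x) ∧ ∑ x, π x = 1 ∧ π ᵥ* A = π

/-- One transition `((i_t, g_t), y_t, u_t, (i_{t+1}, g_{t+1}), reward received in i_{t+1})`. -/
abbrev Transition (S U Y G : Type*) := (S × G) × Y × U × (S × G) × ℝ

namespace Transition

/-- The world/I-state pair `(i_t, g_t)`. -/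
def source (e : Transition S U Y G) : S × G := e.1
/-- The observation `y_t`. -/
def obs (e : Transition S U Y G) : Y := e.2.1
/-- The action `u_t`. -/
def action (e : Transition S U Y G) : U := e.2.2.1
/-- The world/I-state pair `(i_{t+1}, g_{t+1})`. -/
def target (e : Transition S U Y G) : S × G := e.2.2.2.1
/-- The reward received in `i_{t+1}`. -/
def reward (e : Transition S U Y G) : ℝ := e.2.2.2.2

end Transition

section Runs

variable [MeasurableSpace S] [MeasurableSpace U] [MeasurableSpace Y] [MeasurableSpace G]

/-- The law of a transition out of `(i, g)`: observe `y ∼ ν(·|i)`, draw `h ∼ ω(·|φ,g,y)`, then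
`u ∼ μ(·|θ,h,y)`, then `j ∼ q(·|i,u)`, then the reward from the law of the reward of `j`. -/
def stepLaw (M : POMDP S U Y) (C : Controller G U Y nθ nφ) (θ : Fin nθ → ℝ) (φ : Fin nφ → ℝ)
    (x : S × G) : Measure (Transition S U Y G) :=
  ∑ y, ∑ h, ∑ u, ∑ j,
    ENNReal.ofReal (M.ν x.1 y * C.ω φ x.2 y h * C.μ θ h y u * M.q x.1 u j) •
      (M.rewardLaw j).map (fun ρ => ((x, y, u, (j, h), ρ) : Transition S U Y G))

theorem stepLaw_isProb (M : POMDP S U Y) (C : Controller G U Y nθ nφ) (θ : Fin nθ → ℝ)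
    (φ : Fin nφ → ℝ) (x : S × G) : IsProbabilityMeasure (stepLaw M C θ φ x) := by
  constructor
  have hm : ∀ y h u j, ((M.rewardLaw j).map
      (fun ρ => ((x, y, u, (j, h), ρ) : Transition S U Y G))) Set.univ = 1 := by
    intro y h u j
    rw [Measure.map_apply (by fun_prop) MeasurableSet.univ]
    simp
  have h0 : ∀ y h u j, 0 ≤ M.ν x.1 y * C.ω φ x.2 y h * C.μ θ h y u * M.q x.1 u j := by
    intro y h u j
    have := M.ν_nonneg x.1 y
    have := C.ω_nonneg φ x.2 y h
    have := C.μ_nonneg θ h y u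
    have := M.q_nonneg x.1 u j
    positivity
  simp only [stepLaw, Measure.coe_finsetSum, Finset.sum_apply, Measure.smul_apply, hm,
    smul_eq_mul, mul_one]
  simp_rw [← ENNReal.ofReal_sum_of_nonneg (fun j _ => h0 _ _ _ j), ← Finset.mul_sum, M.q_sum,
    mul_one]
  have h1 : ∀ y h u, 0 ≤ M.ν x.1 y * C.ω φ x.2 y h * C.μ θ h y u := fun y h u =>
    mul_nonneg (mul_nonneg (M.ν_nonneg _ _) (C.ω_nonneg _ _ _ _)) (C.μ_nonneg _ _ _ _)
  simp_rw [← ENNReal.ofReal_sum_of_nonneg (fun u _ => h1 _ _ u), ← Finset.mul_sum, C.μ_sum,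
    mul_one]
  have h2 : ∀ y h, 0 ≤ M.ν x.1 y * C.ω φ x.2 y h := fun y h =>
    mul_nonneg (M.ν_nonneg _ _) (C.ω_nonneg _ _ _ _)
  simp_rw [← ENNReal.ofReal_sum_of_nonneg (fun h _ => h2 _ h), ← Finset.mul_sum, C.ω_sum,
    mul_one]
  rw [← ENNReal.ofReal_sum_of_nonneg (fun y _ => M.ν_nonneg _ y), M.ν_sum, ENNReal.ofReal_one]

variable [MeasurableSingletonClass S] [MeasurableSingletonClass G]

/-- `stepLaw` as a Markov kernel. -/
def stepKernel (M : POMDP S U Y) (C : Controller G U Y nθ nφ) (θ : Fin nθ → ℝ)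
    (φ : Fin nφ → ℝ) : Kernel (S × G) (Transition S U Y G) :=
  Kernel.ofFunOfCountable (stepLaw M C θ φ)

instance (M : POMDP S U Y) (C : Controller G U Y nθ nφ) (θ : Fin nθ → ℝ) (φ : Fin nφ → ℝ) :
    IsMarkovKernel (stepKernel M C θ φ) :=
  ⟨fun x => stepLaw_isProb M C θ φ x⟩

/-- The conditional law of the transition at time `t + 1` given the transitions up to time `t`:
a fresh transition out of the pair that was reached last. -/
def nextKernel (M : POMDP S U Y) (C : Controller G U Y nθ nφ) (θ : Fin nθ → ℝ) (φ : Fin nφ → ℝ)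
    (t : ℕ) : Kernel (Finset.Iic t → Transition S U Y G) (Transition S U Y G) :=
  (stepKernel M C θ φ).comap
    (fun hist => (hist ⟨t, Finset.mem_Iic.2 le_rfl⟩).target)
    (by unfold Transition.target; fun_prop)

instance (M : POMDP S U Y) (C : Controller G U Y nθ nφ) (θ : Fin nθ → ℝ) (φ : Fin nφ → ℝ)
    (t : ℕ) : IsMarkovKernel (nextKernel M C θ φ t) := by
  unfold nextKernel; infer_instance

/-- The law of the run (the sequence of transitions at times `t = 0, 1, 2, …`) of the controller
`C` with parameters `θ, φ` in the world `M`, when `(i_0, g_0)` has the law `init`. -/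
def runLaw (M : POMDP S U Y) (C : Controller G U Y nθ nφ) (θ : Fin nθ → ℝ) (φ : Fin nφ → ℝ)
    (init : Measure (S × G)) : Measure (ℕ → Transition S U Y G) :=
  Kernel.trajMeasure (X := fun _ => Transition S U Y G)
    (init.bind (stepKernel M C θ φ)) (nextKernel M C θ φ)

/-- The discounted reward `J_β(i,g) = E[∑_{t ≥ 0} β^t r(i_t) | i_0 = i, g_0 = g]`. -/
def J (M : POMDP S U Y) (C : Controller G U Y nθ nφ) (θ : Fin nθ → ℝ) (φ : Fin nφ → ℝ) (β : ℝ)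
    (x : S × G) : ℝ :=
  ∫ X, ∑' t : ℕ, β ^ t * M.r (X t).source.1 ∂(runLaw M C θ φ (Measure.dirac x))

end Runs

/-- The score of a transition: `∇μ(u_t|θ,g_{t+1},y_t) / μ(u_t|θ,g_{t+1},y_t)` in the coordinates
of `θ`, and `∇ω(g_{t+1}|φ,g_t,y_t) / ω(g_{t+1}|φ,g_t,y_t)` in the coordinates of `φ`. -/
def score (C : Controller G U Y nθ nφ) (θ : Fin nθ → ℝ) (φ : Fin nφ → ℝ)
    (e : Transition S U Y G) : Fin nθ ⊕ Fin nφ → ℝ :=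
  Sum.elim
    (fun k => pderiv (fun θ' => C.μ θ' e.target.2 e.obs e.action) θ k /
      C.μ θ e.target.2 e.obs e.action)
    (fun l => pderiv (fun φ' => C.ω φ' e.source.2 e.obs e.target.2) φ l /
      C.ω φ e.source.2 e.obs e.target.2)

/-- The eligibility trace `z_t = [z^θ_t, z^φ_t]` along the run `X`. -/
def elig (C : Controller G U Y nθ nφ) (θ : Fin nθ → ℝ) (φ : Fin nφ → ℝ) (β : ℝ)
    (X : ℕ → Transition S U Y G) : ℕ → Fin nθ ⊕ Fin nφ → ℝ
  | 0 => 0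
  | t + 1 => β • elig C θ φ β X t + score C θ φ (X t)

/-- The estimate `Δ_t = [Δ^θ_t, Δ^φ_t]` of IState-GPOMDP after `t` iterations along the run `X`. -/
def estimate (C : Controller G U Y nθ nφ) (θ : Fin nθ → ℝ) (φ : Fin nφ → ℝ) (β : ℝ)
    (X : ℕ → Transition S U Y G) : ℕ → Fin nθ ⊕ Fin nφ → ℝ
  | 0 => 0
  | t + 1 => estimate C θ φ β X t +
      (1 / ((t : ℝ) + 1)) • ((X t).reward • elig C θ φ β X (t + 1) - estimate C θ φ β X t)

end IStatePOMDP

end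

/-!
The estimate after `T` iterations is the average of `r_{t+1} z_{t+1}` over `t < T`
(`estimate_eq`). Its limit is found by solving a Poisson equation for the pair formed by the
current world/I-state pair `x` and the current eligibility trace `z`, which turns the average
into an average of centred increments.

Write `D = gradP k` and `η = π D J` for a fixed parameter `k`. Averaging the score over the
transitions from `x` to `x'` gives `D x x'` (`gradP_apply`). Together with the Bellman equation
`J = r + β P J` (`J_eq`), this shows that the function `w(x, z) = z (J x - r x) + b x`, where
`b - P b = D J - η` (`exists_poisson`), satisfies
`E[r' z' + w(x', z') | x, z] = w(x, z) + η`, where primes denote the values one step later. Hence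
`r_{t+2} z_{t+2} - η` is a centred increment plus the telescoping difference
`w(x_{t+1}, z_{t+1}) - w(x_{t+2}, z_{t+2})`, and `w` is bounded along the run because the scores
are bounded, so that the traces are bounded by a geometric series (`abs_elig_le`).

The centred increments are bounded and pairwise orthogonal, by the Markov property of the run
(`integral_runLaw_succ`), so that their averages tend to zero almost surely
(`ae_tendsto_avg_of_orthogonal`). The Poisson equation is solvable because uniqueness of the
stationary distribution forces every signed invariant vector to be a multiple of it
(`exists_eq_smul_of_invariant`). No aperiodicity or irreducibility is needed.
-/

noncomputable section

namespace IStatePOMDP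

/-! ### A strong law for bounded orthogonal random variables -/

section Orthogonal

variable {Ω : Type*} [MeasurableSpace Ω] {μ : Measure Ω} [IsProbabilityMeasure μ]
  {d : ℕ → Ω → ℝ} {C : ℝ}

/-- Orthogonality makes the second moment of a partial sum grow only linearly. -/
theorem integral_sq_sum_le (hm : ∀ n, Measurable (d n)) (hb : ∀ n, ∀ᵐ ω ∂μ, |d n ω| ≤ C)
    (ho : ∀ i j, i < j → ∫ ω, d i ω * d j ω ∂μ = 0) (n : ℕ) :
    ∫ ω, (∑ i ∈ Finset.range n, d i ω) ^ 2 ∂μ ≤ n * C ^ 2 := by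
  have hmem : ∀ n, MemLp (d n) 2 μ := fun n =>
    MemLp.of_bound (hm n).aestronglyMeasurable C (hb n)
  have hS : ∀ n, MemLp (fun ω => ∑ i ∈ Finset.range n, d i ω) 2 μ := fun n =>
    memLp_finsetSum _ fun i _ => hmem i
  induction n with
  | zero => simp
  | succ n ih =>
    have hcross : ∫ ω, (∑ i ∈ Finset.range n, d i ω) * d n ω ∂μ = 0 := by
      simp_rw [Finset.sum_mul]
      rw [integral_finsetSum _ fun i _ => (show Integrable (fun ω => d i ω * d n ω) μ from
        (hmem i).integrable_mul (hmem n))]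
      exact Finset.sum_eq_zero fun i hi => ho i n (Finset.mem_range.1 hi)
    have hsq : ∫ ω, d n ω ^ 2 ∂μ ≤ C ^ 2 := by
      calc ∫ ω, d n ω ^ 2 ∂μ ≤ ∫ _, C ^ 2 ∂μ := by
            refine integral_mono_ae (hmem n).integrable_sq (integrable_const _) ?_
            filter_upwards [hb n] with ω hω
            exact sq_le_sq' (abs_le.1 hω).1 (abs_le.1 hω).2
        _ = C ^ 2 := by simp
    have hexp : ∀ ω, (∑ i ∈ Finset.range (n + 1), d i ω) ^ 2 =
        (∑ i ∈ Finset.range n, d i ω) ^ 2 + 2 * ((∑ i ∈ Finset.range n, d i ω) * d n ω) +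
          d n ω ^ 2 := by
      intro ω; rw [Finset.sum_range_succ]; ring
    have hi1 : Integrable (fun ω => 2 * ((∑ i ∈ Finset.range n, d i ω) * d n ω)) μ :=
      ((hS n).integrable_mul (hmem n)).const_mul 2
    simp_rw [hexp]
    have hi2 : Integrable (fun ω => (∑ i ∈ Finset.range n, d i ω) ^ 2 +
        2 * ((∑ i ∈ Finset.range n, d i ω) * d n ω)) μ := (hS n).integrable_sq.add hi1
    rw [integral_add hi2 (hmem n).integrable_sq,
      integral_add (hS n).integrable_sq hi1, integral_const_mul, hcross]
    push_cast
    linarith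

/-- Along the squares the averages tend to zero, since their second moments are summable. -/
theorem ae_tendsto_avg_sq (hm : ∀ n, Measurable (d n)) (hb : ∀ n, ∀ᵐ ω ∂μ, |d n ω| ≤ C)
    (ho : ∀ i j, i < j → ∫ ω, d i ω * d j ω ∂μ = 0) :
    ∀ᵐ ω ∂μ, Tendsto (fun k : ℕ => (∑ i ∈ Finset.range (k ^ 2), d i ω) / (k : ℝ) ^ 2)
      atTop (𝓝 0) := by
  set Y : ℕ → Ω → ℝ := fun k ω => (∑ i ∈ Finset.range (k ^ 2), d i ω) / (k : ℝ) ^ 2 with hY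
  have hYm : ∀ k, Measurable (Y k) := fun k =>
    (Finset.measurable_sum _ fun i _ => hm i).div_const _
  have hS : ∀ n, MemLp (fun ω => ∑ i ∈ Finset.range n, d i ω) 2 μ := fun n =>
    memLp_finsetSum _ fun i _ => MemLp.of_bound (hm i).aestronglyMeasurable C (hb i)
  have hint : ∀ k, Integrable (fun ω => Y k ω ^ 2) μ := by
    intro k
    simp only [hY, div_pow]
    exact (hS (k ^ 2)).integrable_sq.div_const _
  have hle : ∀ k, ∫⁻ ω, ENNReal.ofReal (Y k ω ^ 2) ∂μ ≤
      ENNReal.ofReal (C ^ 2 * (1 / (k : ℝ) ^ 2)) := by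
    intro k
    rw [← ofReal_integral_eq_lintegral_ofReal (hint k) (ae_of_all _ fun ω => sq_nonneg _)]
    refine ENNReal.ofReal_le_ofReal ?_
    simp only [hY, div_pow]
    rw [integral_div]
    rcases Nat.eq_zero_or_pos k with rfl | hk
    · simp
    · have h := integral_sq_sum_le hm hb ho (k ^ 2)
      push_cast at h
      rw [div_le_iff₀ (by positivity)]
      refine h.trans (le_of_eq ?_)
      field_simp
  have hsum : ∑' k : ℕ, ENNReal.ofReal (C ^ 2 * (1 / (k : ℝ) ^ 2)) ≠ ⊤ :=
    ((Real.summable_one_div_nat_pow.2 one_lt_two).mul_left _).tsum_ofReal_ne_top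
  have hfin : ∫⁻ ω, ∑' k, ENNReal.ofReal (Y k ω ^ 2) ∂μ ≠ ⊤ := by
    rw [lintegral_tsum fun k => ((hYm k).pow_const 2).ennreal_ofReal.aemeasurable]
    exact ne_top_of_le_ne_top hsum (ENNReal.tsum_le_tsum hle)
  filter_upwards [ae_lt_top (Measurable.tsum fun k => ((hYm k).pow_const 2).ennreal_ofReal)
    hfin] with ω hω
  have h1 := ENNReal.tendsto_atTop_zero_of_tsum_ne_top hω.ne
  have h2 : Tendsto (fun k => Y k ω ^ 2) atTop (𝓝 0) := by
    have := (ENNReal.tendsto_toReal ENNReal.zero_ne_top).comp h1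
    simpa [Function.comp_def, ENNReal.toReal_ofReal, sq_nonneg] using this
  have h3 := h2.sqrt
  simp only [Real.sqrt_sq_eq_abs, Real.sqrt_zero] at h3
  exact tendsto_zero_iff_abs_tendsto_zero _ |>.2 h3

/-- A strong law of large numbers for uniformly bounded, pairwise orthogonal random variables:
the averages tend to zero along the squares, and boundedness controls them in between. -/
theorem ae_tendsto_avg_of_orthogonal (hm : ∀ n, Measurable (d n))
    (hb : ∀ n, ∀ᵐ ω ∂μ, |d n ω| ≤ C) (ho : ∀ i j, i < j → ∫ ω, d i ω * d j ω ∂μ = 0) :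
    ∀ᵐ ω ∂μ, Tendsto (fun n : ℕ => (∑ i ∈ Finset.range n, d i ω) / (n : ℝ)) atTop (𝓝 0) := by
  filter_upwards [ae_tendsto_avg_sq hm hb ho, ae_all_iff.2 hb] with ω hω hbω
  have hC : 0 ≤ C := (abs_nonneg _).trans (hbω 0)
  have hsqrt : Tendsto Nat.sqrt atTop atTop :=
    tendsto_atTop.2 fun b => (eventually_ge_atTop (b * b)).mono fun n hn => Nat.le_sqrt.2 hn
  have hlim : Tendsto (fun n : ℕ =>
      |(∑ i ∈ Finset.range (Nat.sqrt n ^ 2), d i ω) / (Nat.sqrt n : ℝ) ^ 2| +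
        2 * C / (Nat.sqrt n : ℝ)) atTop (𝓝 0) := by
    have h1 := (tendsto_zero_iff_abs_tendsto_zero _).1 (hω.comp hsqrt)
    have h2 := (tendsto_const_div_atTop_nhds_zero_nat (2 * C)).comp hsqrt
    simpa using h1.add h2
  refine squeeze_zero_norm' ?_ hlim
  filter_upwards [eventually_ge_atTop 1] with n hn
  set k := Nat.sqrt n with hk
  have hk1 : 1 ≤ k := Nat.le_sqrt.2 (by simpa using hn)
  have hkn : k ^ 2 ≤ n := Nat.sqrt_le' n
  have hnk : n ≤ k ^ 2 + 2 * k := by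
    have := Nat.sqrt_le_add n
    rw [← hk] at this
    nlinarith
  have hk0 : (0 : ℝ) < k := by exact_mod_cast hk1
  have hkn' : (k : ℝ) ^ 2 ≤ n := by exact_mod_cast hkn
  have hnk' : (n : ℝ) - k ^ 2 ≤ 2 * k := by
    have : (n : ℝ) ≤ k ^ 2 + 2 * k := by exact_mod_cast hnk
    linarith
  -- There are at most `2 √n` indices between `⌊√n⌋²` and `n`, which is `o(n)`.
  have hgap : |∑ i ∈ Finset.Ico (k ^ 2) n, d i ω| ≤ 2 * C * k := by
    calc |∑ i ∈ Finset.Ico (k ^ 2) n, d i ω| ≤ ∑ i ∈ Finset.Ico (k ^ 2) n, |d i ω| :=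
          Finset.abs_sum_le_sum_abs _ _
      _ ≤ ∑ i ∈ Finset.Ico (k ^ 2) n, C := Finset.sum_le_sum fun i _ => hbω i
      _ = ((n : ℝ) - k ^ 2) * C := by simp [Nat.cast_sub hkn]
      _ ≤ 2 * k * C := mul_le_mul_of_nonneg_right hnk' hC
      _ = 2 * C * k := by ring
  rw [← Finset.sum_range_add_sum_Ico _ hkn, Real.norm_eq_abs, abs_div, abs_div,
    abs_of_nonneg (by positivity : (0 : ℝ) ≤ (k : ℝ) ^ 2), Nat.abs_cast]
  calc _ ≤ (|∑ i ∈ Finset.range (k ^ 2), d i ω| + 2 * C * k) / (k : ℝ) ^ 2 := by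
        refine div_le_div₀ (by positivity) ((abs_add_le _ _).trans ?_) (by positivity) hkn'
        gcongr
    _ = _ := by field_simp

end Orthogonal

/-! ### The Poisson equation of a stochastic matrix -/

section Poisson

variable {X : Type*} [Fintype X] {A : Matrix X X ℝ} {π : X → ℝ}

theorem sum_vecMul_of_rowSum_one (hA : ∀ x, ∑ y, A x y = 1) (v : X → ℝ) :
    ∑ y, (v ᵥ* A) y = ∑ x, v x := by
  simp only [Matrix.vecMul, dotProduct]
  rw [Finset.sum_comm]
  simp [← Finset.mul_sum, hA]

theorem eq_smul_of_invariant_of_nonneg (hπ : ∀ v, IsStationary A v → v = π) {w : X → ℝ}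
    (h0 : ∀ x, 0 ≤ w x) (hw : w ᵥ* A = w) : w = (∑ x, w x) • π := by
  rcases (Finset.sum_nonneg fun x _ => h0 x : 0 ≤ ∑ x, w x).eq_or_lt' with hs | hs
  · funext x
    have := (Finset.sum_eq_zero_iff_of_nonneg fun x _ => h0 x).1 hs x (Finset.mem_univ x)
    simp [hs, this]
  · have hst : IsStationary A ((∑ x, w x)⁻¹ • w) := by
      refine ⟨fun x => mul_nonneg (inv_nonneg.2 hs.le) (h0 x), ?_, ?_⟩
      · simp only [Pi.smul_apply, smul_eq_mul, ← Finset.mul_sum]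
        exact inv_mul_cancel₀ hs.ne'
      · rw [Matrix.smul_vecMul, hw]
    rw [← hπ _ hst, smul_inv_smul₀ hs.ne']

/-- If the stationary distribution is unique, then every signed invariant vector is a multiple of
it: with `v` also `|v|` is invariant, since `|v| ≤ |v| A` entrywise and both have the same sum. -/
theorem exists_eq_smul_of_invariant (hA0 : ∀ x y, 0 ≤ A x y) (hA : ∀ x, ∑ y, A x y = 1)
    (hπ : ∀ v, IsStationary A v → v = π) {v : X → ℝ} (hv : v ᵥ* A = v) :
    ∃ c : ℝ, v = c • π := by
  have hle : ∀ y, |v y| ≤ ((fun x => |v x|) ᵥ* A) y := by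
    intro y
    conv_lhs => rw [← hv]
    simp only [Matrix.vecMul, dotProduct]
    refine (Finset.abs_sum_le_sum_abs _ _).trans (le_of_eq ?_)
    simp [abs_mul, abs_of_nonneg (hA0 _ _)]
  have habs : (fun x => |v x|) ᵥ* A = fun x => |v x| := by
    funext y
    have := (Finset.sum_eq_sum_iff_of_le fun y _ => hle y).1
      (sum_vecMul_of_rowSum_one hA fun x => |v x|).symm
    exact (this y (Finset.mem_univ y)).symm
  have h1 := eq_smul_of_invariant_of_nonneg hπ (fun x => abs_nonneg (v x)) habs
  have h2 := eq_smul_of_invariant_of_nonneg hπ (w := v + fun x => |v x|)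
    (fun x => by have := neg_abs_le (v x); simp only [Pi.add_apply]; linarith)
    (by rw [Matrix.add_vecMul, hv, habs])
  refine ⟨∑ x, (v + fun x => |v x|) x - ∑ x, |v x|, ?_⟩
  calc v = (v + fun x => |v x|) - fun x => |v x| := by simp
    _ = (∑ x, (v + fun x => |v x|) x) • π - (∑ x, |v x|) • π := by rw [← h1, ← h2]
    _ = _ := (sub_smul _ _ _).symm

/-- The Poisson equation `b - A b = f - (π · f)` is solvable when the stationary distribution `π`
is unique: a functional that vanishes on the range of `1 - A` is a multiple of `π`. -/
theorem exists_poisson (hA0 : ∀ x y, 0 ≤ A x y) (hA : ∀ x, ∑ y, A x y = 1)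
    (hst : IsStationary A π) (hπ : ∀ v, IsStationary A v → v = π) (f : X → ℝ) :
    ∃ b : X → ℝ, ∀ x, b x - (A *ᵥ b) x = f x - π ⬝ᵥ f := by
  classical
  set g : X → ℝ := fun x => f x - π ⬝ᵥ f with hg
  suffices h : g ∈ LinearMap.range (Matrix.mulVecLin (1 - A)) by
    obtain ⟨b, hb⟩ := h
    refine ⟨b, fun x => ?_⟩
    have := congrFun hb x
    simpa [Matrix.sub_mulVec] using this
  by_contra hmem
  obtain ⟨ℓ, hℓ, hker⟩ := Submodule.exists_le_ker_of_notMem hmem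
  obtain ⟨v, rfl⟩ : ∃ v : X → ℝ, ℓ = dotProductBilin ℝ ℝ v := by
    refine ⟨fun x => ℓ (Pi.single x 1), ?_⟩
    ext x
    simp
  have hinv : v ᵥ* (1 - A) = 0 := by
    funext y
    have := hker ⟨Pi.single y 1, rfl⟩
    rw [LinearMap.mem_ker] at this
    rw [Matrix.mulVecLin_apply, dotProductBilin_apply_apply, Matrix.dotProduct_mulVec,
      dotProduct_single_one] at this
    exact this
  obtain ⟨c, rfl⟩ := exists_eq_smul_of_invariant hA0 hA hπ (v := v) (by
    rw [Matrix.vecMul_sub, Matrix.vecMul_one, sub_eq_zero] at hinv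
    exact hinv.symm)
  refine hℓ ?_
  have : π ⬝ᵥ g = 0 := by
    simp only [hg, dotProduct, mul_sub, Finset.sum_sub_distrib, ← Finset.sum_mul, hst.2.1]
    ring
  simp [this]

end Poisson

/-! ### Measurability of transitions and histories -/

section Transitions

variable {S U Y G : Type*} [MeasurableSpace S] [MeasurableSpace U] [MeasurableSpace Y]
  [MeasurableSpace G]

theorem measurable_source : Measurable (Transition.source : Transition S U Y G → S × G) := by
  unfold Transition.source; fun_prop

theorem measurable_target : Measurable (Transition.target : Transition S U Y G → S × G) := by
  unfold Transition.target; fun_prop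

theorem measurable_reward : Measurable (Transition.reward : Transition S U Y G → ℝ) := by
  unfold Transition.reward; fun_prop

/-- The events of the first `t + 1` transitions of a run. -/
abbrev history (S U Y G : Type*) [MeasurableSpace S] [MeasurableSpace U] [MeasurableSpace Y]
    [MeasurableSpace G] (t : ℕ) : MeasurableSpace (ℕ → Transition S U Y G) :=
  MeasurableSpace.comap (Preorder.frestrictLe (π := fun _ => Transition S U Y G) t)
    MeasurableSpace.pi

theorem measurable_history_coord {i t : ℕ} (h : i ≤ t) :
    Measurable[history S U Y G t] (fun X : ℕ → Transition S U Y G => X i) :=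
  (measurable_pi_apply (⟨i, Finset.mem_Iic.2 h⟩ : Finset.Iic t)).comp
    (comap_measurable (Preorder.frestrictLe (π := fun _ => Transition S U Y G) t))

theorem history_le (t : ℕ) : history S U Y G t ≤ MeasurableSpace.pi :=
  (Preorder.measurable_frestrictLe t).comap_le

theorem history_mono : Monotone (history S U Y G) := by
  intro i t h
  refine MeasurableSpace.comap_le_iff_le_map.2 fun s hs => ?_
  exact ((Preorder.measurable_frestrictLe₂ (X := fun _ => Transition S U Y G) h).comp
    (comap_measurable (Preorder.frestrictLe (π := fun _ => Transition S U Y G) t))) hs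

end Transitions

/-! ### The law of one transition -/

section StepLaw

variable {S U Y G : Type*} [Fintype S] [Fintype U] [Fintype Y] [Fintype G] {nθ nφ : ℕ}

/-- The probability of observing `y`, moving to the pair `x'` and taking the action `u` on the way,
out of the pair `x`. -/
def weight (M : POMDP S U Y) (C : Controller G U Y nθ nφ) (θ : Fin nθ → ℝ) (φ : Fin nφ → ℝ)
    (x : S × G) (y : Y) (u : U) (x' : S × G) : ℝ :=
  M.ν x.1 y * C.ω φ x.2 y x'.2 * C.μ θ x'.2 y u * M.q x.1 u x'.1

variable (M : POMDP S U Y) (C : Controller G U Y nθ nφ) (θ : Fin nθ → ℝ) (φ : Fin nφ → ℝ)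

theorem weight_nonneg (x : S × G) (y : Y) (u : U) (x' : S × G) :
    0 ≤ weight M C θ φ x y u x' :=
  mul_nonneg (mul_nonneg (mul_nonneg (M.ν_nonneg _ _) (C.ω_nonneg _ _ _ _))
    (C.μ_nonneg _ _ _ _)) (M.q_nonneg _ _ _)

theorem P_apply (x x' : S × G) : P M C θ φ x x' = ∑ y, ∑ u, weight M C θ φ x y u x' := rfl

theorem P_nonneg (x x' : S × G) : 0 ≤ P M C θ φ x x' :=
  Finset.sum_nonneg fun _ _ => Finset.sum_nonneg fun _ _ => weight_nonneg M C θ φ _ _ _ _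

/-- The summation order of `stepLaw` against that of `P`. -/
theorem sum_reorder (F : Y → U → S × G → ℝ) :
    ∑ y, ∑ h, ∑ u, ∑ j, F y u (j, h) = ∑ x', ∑ y, ∑ u, F y u x' := by
  have h1 : ∀ y, ∑ h, ∑ u, ∑ j, F y u (j, h) = ∑ x', ∑ u, F y u x' := by
    intro y
    rw [Fintype.sum_prod_type_right]
    exact Finset.sum_congr rfl fun h _ => Finset.sum_comm
  simp_rw [h1]
  exact Finset.sum_comm

variable [MeasurableSpace S] [MeasurableSpace U] [MeasurableSpace Y] [MeasurableSpace G]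

theorem stepLaw_eq (x : S × G) :
    stepLaw M C θ φ x = ∑ y, ∑ h, ∑ u, ∑ j, ENNReal.ofReal (weight M C θ φ x y u (j, h)) •
      (M.rewardLaw j).map (fun ρ => ((x, y, u, (j, h), ρ) : Transition S U Y G)) := rfl

theorem ae_stepLaw {x : S × G} {p : Transition S U Y G → Prop} (hp : MeasurableSet {e | p e})
    (h : ∀ y u x', ∀ᵐ ρ ∂(M.rewardLaw x'.1), p (x, y, u, x', ρ)) :
    ∀ᵐ e ∂(stepLaw M C θ φ x), p e := by
  have hcomp : ∀ y h u j, (ENNReal.ofReal (weight M C θ φ x y u (j, h)) •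
      (M.rewardLaw j).map (fun ρ => ((x, y, u, (j, h), ρ) : Transition S U Y G)))
        {e | ¬ p e} = 0 := by
    intro y g u j
    have : ∀ᵐ e ∂((M.rewardLaw j).map
        (fun ρ => ((x, y, u, (j, g), ρ) : Transition S U Y G))), p e :=
      (ae_map_iff (by fun_prop) hp).2 (h y u (j, g))
    rw [Measure.smul_apply, ae_iff.1 this, smul_zero]
  rw [ae_iff, stepLaw_eq]
  simp only [Measure.coe_finsetSum, Finset.sum_apply, hcomp, Finset.sum_const_zero]

theorem integral_stepLaw {x : S × G} {f : Transition S U Y G → ℝ} (hf : Measurable f)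
    (hi : ∀ y u x', Integrable (fun ρ => f (x, y, u, x', ρ)) (M.rewardLaw x'.1)) :
    ∫ e, f e ∂(stepLaw M C θ φ x) = ∑ x', ∑ y, ∑ u, weight M C θ φ x y u x' *
      ∫ ρ, f (x, y, u, x', ρ) ∂(M.rewardLaw x'.1) := by
  have h4 : ∀ y h u j, Integrable f (ENNReal.ofReal (weight M C θ φ x y u (j, h)) •
      (M.rewardLaw j).map (fun ρ => ((x, y, u, (j, h), ρ) : Transition S U Y G))) :=
    fun y h u j => Integrable.smul_measure
      ((integrable_map_measure hf.aestronglyMeasurable (by fun_prop)).2 (hi y u (j, h)))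
      ENNReal.ofReal_ne_top
  have h3 := fun y h u => integrable_finsetSum_measure.2 fun j (_ : j ∈ Finset.univ) => h4 y h u j
  have h2 := fun y h => integrable_finsetSum_measure.2 fun u (_ : u ∈ Finset.univ) => h3 y h u
  have h1 := fun y => integrable_finsetSum_measure.2 fun h (_ : h ∈ Finset.univ) => h2 y h
  rw [stepLaw_eq, integral_finsetSum_measure fun y _ => h1 y]
  simp_rw [integral_finsetSum_measure fun h _ => h2 _ h,
    integral_finsetSum_measure fun u _ => h3 _ _ u,
    integral_finsetSum_measure fun j _ => h4 _ _ _ j, integral_smul_measure]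
  rw [← sum_reorder]
  refine Finset.sum_congr rfl fun y _ => Finset.sum_congr rfl fun h _ =>
    Finset.sum_congr rfl fun u _ => Finset.sum_congr rfl fun j _ => ?_
  rw [integral_map (by fun_prop) hf.aestronglyMeasurable,
    ENNReal.toReal_ofReal (weight_nonneg _ _ _ _ _ _ _ _), smul_eq_mul]

variable [MeasurableSingletonClass S] [MeasurableSingletonClass G]

theorem ae_stepLaw_source (x : S × G) : ∀ᵐ e ∂(stepLaw M C θ φ x), e.source = x :=
  ae_stepLaw M C θ φ (measurable_source (measurableSet_singleton x))
    fun _ _ _ => ae_of_all _ fun _ => rfl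

theorem integral_stepLaw_source (g : S × G → ℝ) (x : S × G) :
    ∫ e, g e.source ∂(stepLaw M C θ φ x) = g x := by
  have := stepLaw_isProb M C θ φ x
  rw [integral_congr_ae (g := fun _ => g x)
    ((ae_stepLaw_source M C θ φ x).mono fun e he => by simp only [he])]
  simp

theorem integral_stepLaw_target (g : S × G → ℝ) (x : S × G) :
    ∫ e, g e.target ∂(stepLaw M C θ φ x) = (P M C θ φ *ᵥ g) x := by
  have hg : Measurable (fun e : Transition S U Y G => g e.target) :=
    (Measurable.of_discrete (f := g)).comp measurable_target
  rw [integral_stepLaw M C θ φ hg fun y u x' => integrable_const (g x')]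
  refine Finset.sum_congr rfl fun x' _ => ?_
  simp [Transition.target, P_apply, Finset.sum_mul]

theorem P_rowSum (x : S × G) : ∑ x', P M C θ φ x x' = 1 := by
  have := stepLaw_isProb M C θ φ x
  have h := integral_stepLaw_target M C θ φ (fun _ => 1) x
  simpa [Matrix.mulVec, dotProduct] using h.symm

end StepLaw

/-! ### The Markov property of the run and the Bellman equation -/

section Run

variable {S U Y G : Type*} [Fintype S] [Fintype U] [Fintype Y] [Fintype G] {nθ nφ : ℕ}
  [MeasurableSpace S] [MeasurableSpace U] [MeasurableSpace Y] [MeasurableSpace G]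
  [MeasurableSingletonClass S] [MeasurableSingletonClass G]
  (M : POMDP S U Y) (C : Controller G U Y nθ nφ) (θ : Fin nθ → ℝ) (φ : Fin nφ → ℝ)
  (init : Measure (S × G))

/-- The first transition of a run has the law prescribed at time `0`. -/
theorem runLaw_map_zero :
    (runLaw M C θ φ init).map (fun X => X 0) = init.bind (stepKernel M C θ φ) := by
  have h : (fun X : ℕ → Transition S U Y G => X 0) =
      (MeasurableEquiv.piUnique (fun _ : Finset.Iic 0 => Transition S U Y G)) ∘
        Preorder.frestrictLe (π := fun _ => Transition S U Y G) 0 := rfl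
  rw [h, ← Measure.map_map (by fun_prop) (by fun_prop), runLaw, Kernel.trajMeasure,
    Measure.map_comp _ _ (by fun_prop), Kernel.traj_map_frestrictLe, Kernel.partialTraj_self,
    Measure.id_comp]
  exact MeasurableEquiv.map_map_symm _

variable [IsProbabilityMeasure init]

instance : IsProbabilityMeasure (runLaw M C θ φ init) := by
  unfold runLaw; infer_instance

theorem runLaw_compProd (t : ℕ) :
    ((runLaw M C θ φ init).map (Preorder.frestrictLe t)) ⊗ₘ nextKernel M C θ φ t =
      (runLaw M C θ φ init).map (fun X => (Preorder.frestrictLe t X, X (t + 1))) :=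
  Kernel.map_frestrictLe_trajMeasure_compProd_eq_map_trajMeasure

theorem ae_runLaw_succ {p : Transition S U Y G → Prop} (hp : MeasurableSet {e | p e})
    (h : ∀ x, ∀ᵐ e ∂(stepLaw M C θ φ x), p e) (t : ℕ) :
    ∀ᵐ X ∂(runLaw M C θ φ init), p (X (t + 1)) := by
  have h1 : ∀ᵐ z ∂(((runLaw M C θ φ init).map (Preorder.frestrictLe t)) ⊗ₘ
      nextKernel M C θ φ t), p z.2 :=
    Measure.ae_compProd_of_ae_ae (measurable_snd hp) (ae_of_all _ fun _ => h _)
  rw [runLaw_compProd] at h1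
  have hpair : Measurable
      (fun X : ℕ → Transition S U Y G => (Preorder.frestrictLe t X, X (t + 1))) := by fun_prop
  exact ae_of_ae_map hpair.aemeasurable h1

/-- The Markov property of the run: a function of the history and the next transition is averaged
by first averaging over a fresh transition out of the pair reached last. -/
theorem integral_runLaw_succ {A : (ℕ → Transition S U Y G) → ℝ} {t : ℕ}
    (hA : Measurable[history S U Y G t] A) {f : Transition S U Y G → ℝ} (hf : Measurable f)
    (hi : Integrable (fun X => A X * f (X (t + 1))) (runLaw M C θ φ init)) :
    ∫ X, A X * f (X (t + 1)) ∂(runLaw M C θ φ init) =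
      ∫ X, A X * ∫ e, f e ∂(stepLaw M C θ φ (X t).target) ∂(runLaw M C θ φ init) := by
  obtain ⟨a, ha, rfl⟩ := hA.exists_eq_measurable_comp
  set Φ : (Finset.Iic t → Transition S U Y G) × Transition S U Y G → ℝ := fun z => a z.1 * f z.2
  have hΦ : Measurable Φ := (ha.comp measurable_fst).mul (hf.comp measurable_snd)
  have hpair : Measurable
      (fun X : ℕ → Transition S U Y G => (Preorder.frestrictLe t X, X (t + 1))) := by fun_prop
  have hΦi : Integrable Φ
      ((runLaw M C θ φ init).map (fun X => (Preorder.frestrictLe t X, X (t + 1)))) :=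
    (integrable_map_measure hΦ.aestronglyMeasurable hpair.aemeasurable).2 hi
  have h1 := integral_map hpair.aemeasurable hΦi.aestronglyMeasurable
  rw [← runLaw_compProd] at hΦi
  have h2 := Measure.integral_compProd hΦi
  rw [runLaw_compProd, h1] at h2
  have hm : Measurable (fun hist : Finset.Iic t → Transition S U Y G =>
      a hist * ∫ e, f e ∂(stepLaw M C θ φ (hist ⟨t, Finset.mem_Iic.2 le_rfl⟩).target)) :=
    ha.mul ((Measurable.of_discrete (f := fun x => ∫ e, f e ∂(stepLaw M C θ φ x))).comp
      (measurable_target.comp (measurable_pi_apply _)))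
  have hinner : ∀ hist, ∫ e, Φ (hist, e) ∂(nextKernel M C θ φ t hist) =
      a hist * ∫ e, f e ∂(stepLaw M C θ φ (hist ⟨t, Finset.mem_Iic.2 le_rfl⟩).target) :=
    fun hist => integral_const_mul (a hist) f
  simp_rw [hinner] at h2
  rw [integral_map (by fun_prop) hm.aestronglyMeasurable] at h2
  exact h2

/-- A strong law for the increments `A_t (f(X_{t+1}) - E[f(X_{t+1}) | X_0, …, X_t])` with bounded
predictable `A_t`: they are bounded and pairwise orthogonal. -/
theorem ae_tendsto_avg_increments {A : ℕ → (ℕ → Transition S U Y G) → ℝ}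
    (hA : ∀ t, Measurable[history S U Y G t] (A t)) {c : ℝ} (hAc : ∀ t X, |A t X| ≤ c)
    {f : Transition S U Y G → ℝ} (hf : Measurable f) {K : ℝ}
    (hfK : ∀ x, ∀ᵐ e ∂(stepLaw M C θ φ x), |f e| ≤ K) :
    ∀ᵐ X ∂(runLaw M C θ φ init), Tendsto (fun n : ℕ =>
      (∑ t ∈ Finset.range n, A t X *
        (f (X (t + 1)) - ∫ e, f e ∂(stepLaw M C θ φ (X t).target))) / (n : ℝ)) atTop (𝓝 0) := by
  set m : S × G → ℝ := fun x => ∫ e, f e ∂(stepLaw M C θ φ x) with hm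
  have hmK : ∀ x, |m x| ≤ K := by
    intro x
    have := stepLaw_isProb M C θ φ x
    have h := norm_integral_le_of_norm_le_const (f := f) (C := K) (hfK x)
    simpa [hm] using h
  have hmm : Measurable m := Measurable.of_discrete
  have hcoord : ∀ {i t : ℕ}, i ≤ t → ∀ {g : Transition S U Y G → ℝ}, Measurable g →
      Measurable[history S U Y G t] (fun X : ℕ → Transition S U Y G => g (X i)) :=
    fun h _ hg => hg.comp (measurable_history_coord h)
  have hD : ∀ {i t : ℕ}, i < t → Measurable[history S U Y G t]
      (fun X => A i X * (f (X (i + 1)) - m (X i).target)) := by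
    intro i t hit
    have hAi : Measurable[history S U Y G t] (A i) :=
      (hA i).mono (history_mono hit.le) le_rfl
    exact hAi.mul ((hcoord (Nat.succ_le_of_lt hit) hf).sub
      (hcoord hit.le (hmm.comp measurable_target)))
  have hc : 0 ≤ c := by
    obtain ⟨X⟩ := nonempty_of_isProbabilityMeasure (runLaw M C θ φ init)
    exact (abs_nonneg _).trans (hAc 0 X)
  have hb : ∀ t, ∀ᵐ X ∂(runLaw M C θ φ init),
      |A t X * (f (X (t + 1)) - m (X t).target)| ≤ c * (K + K) := by
    intro t
    filter_upwards [ae_runLaw_succ M C θ φ init (measurableSet_le hf.abs measurable_const) hfK t]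
      with X hX
    rw [abs_mul]
    exact mul_le_mul (hAc t X) ((abs_sub _ _).trans (add_le_add hX (hmK _))) (abs_nonneg _) hc
  have hmeas : ∀ t, Measurable (fun X => A t X * (f (X (t + 1)) - m (X t).target)) := fun t =>
    (hD (Nat.lt_succ_self t)).mono (history_le _) le_rfl
  refine ae_tendsto_avg_of_orthogonal hmeas hb fun i j hij => ?_
  -- Everything but the last centred factor is determined by the history up to time `j`.
  set B : (ℕ → Transition S U Y G) → ℝ :=
    fun X => A i X * (f (X (i + 1)) - m (X i).target) * A j X with hB
  have hBm : Measurable[history S U Y G j] B := (hD hij).mul (hA j)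
  have hBm' : Measurable B := hBm.mono (history_le _) le_rfl
  have hBb : ∀ᵐ X ∂(runLaw M C θ φ init), |B X| ≤ c * (K + K) * c := by
    filter_upwards [hb i] with X hX
    rw [hB, abs_mul]
    exact mul_le_mul hX (hAc j X) (abs_nonneg _) ((abs_nonneg _).trans hX)
  have hi1 : Integrable (fun X => B X * f (X (j + 1))) (runLaw M C θ φ init) := by
    refine Integrable.of_bound (hBm'.mul (hf.comp (measurable_pi_apply _))).aestronglyMeasurable
      (c * (K + K) * c * K) ?_
    filter_upwards [hBb,
      ae_runLaw_succ M C θ φ init (measurableSet_le hf.abs measurable_const) hfK j] with X h1 h2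
    rw [Real.norm_eq_abs, abs_mul]
    exact mul_le_mul h1 h2 (abs_nonneg _) ((abs_nonneg _).trans h1)
  have hi2 : Integrable (fun X => B X * m (X j).target) (runLaw M C θ φ init) := by
    refine Integrable.of_bound (hBm'.mul (hmm.comp (measurable_target.comp
      (measurable_pi_apply _)))).aestronglyMeasurable (c * (K + K) * c * K) ?_
    filter_upwards [hBb] with X h1
    rw [Real.norm_eq_abs, abs_mul]
    exact mul_le_mul h1 (hmK _) (abs_nonneg _) ((abs_nonneg _).trans h1)
  have hsplit : ∀ X : ℕ → Transition S U Y G,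
      A i X * (f (X (i + 1)) - m (X i).target) * (A j X * (f (X (j + 1)) - m (X j).target)) =
        B X * f (X (j + 1)) - B X * m (X j).target := by
    intro X; rw [hB]; ring
  rw [integral_congr_ae (ae_of_all _ hsplit), integral_sub hi1 hi2,
    integral_runLaw_succ M C θ φ init hBm hf hi1, sub_self]

theorem integrable_runLaw_coord {W : Type*} [Finite W] [MeasurableSpace W]
    [DiscreteMeasurableSpace W] (g : W → ℝ) {s : Transition S U Y G → W} (hs : Measurable s)
    (t : ℕ) : Integrable (fun X => g (s (X t))) (runLaw M C θ φ init) := by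
  obtain ⟨K, hK⟩ := Set.Finite.bddAbove (Set.finite_range fun w => |g w|)
  refine Integrable.of_bound (Measurable.aestronglyMeasurable
    ((Measurable.of_discrete (f := g)).comp (hs.comp (measurable_pi_apply _)))) K ?_
  exact ae_of_all _ fun X => hK ⟨_, rfl⟩

theorem integral_target (x : S × G) (g : S × G → ℝ) (t : ℕ) :
    ∫ X, g (X t).target ∂(runLaw M C θ φ (Measure.dirac x)) =
      (P M C θ φ).mulVec^[t + 1] g x := by
  induction t generalizing g with
  | zero =>
    have h := integral_map (μ := runLaw M C θ φ (Measure.dirac x)) (φ := fun X => X 0)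
      (f := fun e => g e.target) (measurable_pi_apply 0).aemeasurable
      ((Measurable.of_discrete (f := g)).comp measurable_target).aestronglyMeasurable
    rw [← h, runLaw_map_zero, Measure.dirac_bind (Kernel.measurable _)]
    exact integral_stepLaw_target M C θ φ g x
  | succ t ih =>
    have h := integral_runLaw_succ M C θ φ (Measure.dirac x) (A := fun _ => 1) (t := t)
      measurable_const (f := fun e => g e.target)
      ((Measurable.of_discrete (f := g)).comp measurable_target)
      (by simpa using integrable_runLaw_coord M C θ φ _ g measurable_target (t + 1))
    simp only [one_mul, integral_stepLaw_target] at h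
    rw [h, ih, ← Function.iterate_succ_apply (P M C θ φ).mulVec]

theorem integral_source (x : S × G) (g : S × G → ℝ) (t : ℕ) :
    ∫ X, g (X t).source ∂(runLaw M C θ φ (Measure.dirac x)) = (P M C θ φ).mulVec^[t] g x := by
  cases t with
  | zero =>
    have h := integral_map (μ := runLaw M C θ φ (Measure.dirac x)) (φ := fun X => X 0)
      (f := fun e => g e.source) (measurable_pi_apply 0).aemeasurable
      ((Measurable.of_discrete (f := g)).comp measurable_source).aestronglyMeasurable
    rw [← h, runLaw_map_zero, Measure.dirac_bind (Kernel.measurable _)]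
    exact integral_stepLaw_source M C θ φ g x
  | succ t =>
    have h := integral_runLaw_succ M C θ φ (Measure.dirac x) (A := fun _ => 1) (t := t)
      measurable_const (f := fun e => g e.source)
      ((Measurable.of_discrete (f := g)).comp measurable_source)
      (by simpa using integrable_runLaw_coord M C θ φ _ g measurable_source (t + 1))
    simp only [one_mul, integral_stepLaw_source] at h
    rw [h, integral_target]

/-- The Neumann series `J = ∑ β^t P^t r`. -/
theorem hasSum_J {β : ℝ} (hβ0 : 0 ≤ β) (hβ1 : β < 1) (x : S × G) :
    HasSum (fun t : ℕ => β ^ t * (P M C θ φ).mulVec^[t] (fun x' => M.r x'.1) x)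
      (J M C θ φ β x) := by
  obtain ⟨K, hK⟩ := Set.Finite.bddAbove (Set.finite_range fun i => |M.r i|)
  have hint : ∀ t : ℕ, Integrable (fun X : ℕ → Transition S U Y G => β ^ t * M.r (X t).source.1)
      (runLaw M C θ φ (Measure.dirac x)) := fun t =>
    (integrable_runLaw_coord M C θ φ _ (fun x' : S × G => M.r x'.1) measurable_source t).const_mul _
  have hsum : Summable fun t : ℕ => ∫ X : ℕ → Transition S U Y G,
      ‖β ^ t * M.r (X t).source.1‖ ∂(runLaw M C θ φ (Measure.dirac x)) := by
    refine Summable.of_nonneg_of_le (fun t => integral_nonneg fun _ => norm_nonneg _) (fun t => ?_)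
      ((summable_geometric_of_lt_one hβ0 hβ1).mul_right K)
    calc _ ≤ ∫ _, β ^ t * K ∂(runLaw M C θ φ (Measure.dirac x)) := by
          refine integral_mono (hint t).norm (integrable_const _) fun X => ?_
          simp only [norm_mul, Real.norm_eq_abs, abs_of_nonneg (pow_nonneg hβ0 t)]
          exact mul_le_mul_of_nonneg_left (hK ⟨_, rfl⟩) (pow_nonneg hβ0 t)
      _ = β ^ t * K := by simp
  have h := hasSum_integral_of_summable_integral_norm hint hsum
  simp_rw [integral_const_mul] at h
  refine h.congr_fun fun t => ?_
  rw [integral_source M C θ φ x (fun x' => M.r x'.1) t]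

/-- The Bellman equation `J = r + β P J`. -/
theorem J_eq {β : ℝ} (hβ0 : 0 ≤ β) (hβ1 : β < 1) (x : S × G) :
    J M C θ φ β x = M.r x.1 + β * (P M C θ φ *ᵥ J M C θ φ β) x := by
  have h1 : HasSum (fun t : ℕ => β ^ (t + 1) * (P M C θ φ).mulVec^[t + 1] (fun x' => M.r x'.1) x)
      (β * (P M C θ φ *ᵥ J M C θ φ β) x) := by
    have h := (hasSum_sum fun y (_ : y ∈ Finset.univ) =>
      (hasSum_J M C θ φ hβ0 hβ1 y).mul_left (P M C θ φ x y)).mul_left β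
    refine h.congr_fun fun t => ?_
    rw [Function.iterate_succ_apply']
    simp only [Matrix.mulVec, dotProduct, Finset.mul_sum]
    exact Finset.sum_congr rfl fun y _ => by ring
  have h2 := (hasSum_nat_add_iff' 1).2 (hasSum_J M C θ φ hβ0 hβ1 x)
  have := h2.unique h1
  simp only [Finset.sum_range_one, pow_zero, one_mul, Function.iterate_zero, id_eq] at this
  linarith

end Run

/-! ### Scores, eligibility traces and the estimate -/

section Score

/-- With `p = 0` the quotient is `0`, so that no positivity is needed. -/
theorem abs_div_le_of_abs_le_mul {a p D : ℝ} (hp : 0 ≤ p) (h : |a| ≤ D * p) :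
    |a / p| ≤ |D| := by
  rw [abs_div, abs_of_nonneg hp]
  refine div_le_of_le_mul₀ hp (abs_nonneg _) (h.trans ?_)
  exact mul_le_mul_of_nonneg_right (le_abs_self D) hp

theorem mul_div_of_abs_le_mul {a p D : ℝ} (h : |a| ≤ D * p) : p * (a / p) = a := by
  rcases eq_or_ne p 0 with rfl | hp
  · have : a = 0 := by simpa using h
    simp [this]
  · field_simp

variable {S U Y G : Type*} [Fintype U] [Fintype G] {nθ nφ : ℕ}
  {C : Controller G U Y nθ nφ} (θ : Fin nθ → ℝ) (φ : Fin nφ → ℝ)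

theorem abs_score_le {D B : ℝ}
    (hD : ∀ θ k h y u, |pderiv (fun θ' => C.μ θ' h y u) θ k| ≤ D * C.μ θ h y u)
    (hB : ∀ φ l g y h, |pderiv (fun φ' => C.ω φ' g y h) φ l| ≤ B * C.ω φ g y h)
    (e : Transition S U Y G) (k : Fin nθ ⊕ Fin nφ) : |score C θ φ e k| ≤ max |D| |B| := by
  rcases k with k | l
  · exact (abs_div_le_of_abs_le_mul (C.μ_nonneg _ _ _ _) (hD θ k _ _ _)).trans (le_max_left _ _)
  · exact (abs_div_le_of_abs_le_mul (C.ω_nonneg _ _ _ _) (hB φ l _ _ _)).trans (le_max_right _ _)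

variable {θ φ}

theorem abs_elig_le {β K : ℝ} (hβ0 : 0 ≤ β) (hβ1 : β < 1) {k : Fin nθ ⊕ Fin nφ}
    (hK : ∀ e : Transition S U Y G, |score C θ φ e k| ≤ K) (X : ℕ → Transition S U Y G) (t : ℕ) :
    |elig C θ φ β X t k| ≤ K / (1 - β) := by
  have h1 : 0 < 1 - β := sub_pos.2 hβ1
  have hK0 : 0 ≤ K := (abs_nonneg _).trans (hK (X 0))
  induction t with
  | zero => simpa [elig] using div_nonneg hK0 h1.le
  | succ t ih =>
    calc |elig C θ φ β X (t + 1) k| = |β * elig C θ φ β X t k + score C θ φ (X t) k| := rfl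
      _ ≤ β * |elig C θ φ β X t k| + |score C θ φ (X t) k| := by
        refine (abs_add_le _ _).trans (le_of_eq ?_)
        rw [abs_mul, abs_of_nonneg hβ0]
      _ ≤ β * (K / (1 - β)) + K := add_le_add (mul_le_mul_of_nonneg_left ih hβ0) (hK _)
      _ = K / (1 - β) := by field_simp; ring

theorem estimate_eq {β : ℝ} (X : ℕ → Transition S U Y G) (k : Fin nθ ⊕ Fin nφ) (T : ℕ) :
    estimate C θ φ β X T k =
      (∑ t ∈ Finset.range T, (X t).reward * elig C θ φ β X (t + 1) k) / (T : ℝ) := by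
  induction T with
  | zero => simp [estimate]
  | succ T ih =>
    have hT : (T : ℝ) + 1 ≠ 0 := by positivity
    have hstep : estimate C θ φ β X (T + 1) k = estimate C θ φ β X T k +
      (1 / ((T : ℝ) + 1)) * ((X T).reward * elig C θ φ β X (T + 1) k -
        estimate C θ φ β X T k) := rfl
    have hmul : (T : ℝ) * estimate C θ φ β X T k =
        ∑ t ∈ Finset.range T, (X t).reward * elig C θ φ β X (t + 1) k := by
      rcases Nat.eq_zero_or_pos T with rfl | h
      · simp
      · rw [ih]; field_simp
    rw [hstep, Finset.sum_range_succ, ← hmul]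
    push_cast
    field_simp
    ring

end Score

/-! ### The gradient of the transition matrix -/

section Gradient

variable {S U Y G : Type*} [Fintype S] [Fintype U] [Fintype Y] [Fintype G] {nθ nφ : ℕ}
  (M : POMDP S U Y) {C : Controller G U Y nθ nφ} (θ : Fin nθ → ℝ) (φ : Fin nφ → ℝ)

/-- The likelihood-ratio identity: averaging the score over the transitions from `x` to `x'`
gives the derivative of the transition probability. Where a probability vanishes, the quotient
in the score is `0`, and so is the derivative, by the bound on the ratio. -/
theorem gradP_apply {D B : ℝ}
    (hμ : ∀ θ k h y u, HasPartialAt (fun θ' => C.μ θ' h y u) θ k)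
    (hω : ∀ φ l g y h, HasPartialAt (fun φ' => C.ω φ' g y h) φ l)
    (hD : ∀ θ k h y u, |pderiv (fun θ' => C.μ θ' h y u) θ k| ≤ D * C.μ θ h y u)
    (hB : ∀ φ l g y h, |pderiv (fun φ' => C.ω φ' g y h) φ l| ≤ B * C.ω φ g y h)
    (k : Fin nθ ⊕ Fin nφ) (x x' : S × G) :
    gradP M C θ φ k x x' =
      ∑ y, ∑ u, weight M C θ φ x y u x' * score C θ φ (x, y, u, x', 0) k := by
  rcases k with k | l
  · have h : HasDerivAt (fun s => P M C (Function.update θ k s) φ x x')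
        (∑ y, ∑ u, M.ν x.1 y * C.ω φ x.2 y x'.2 * pderiv (fun θ' => C.μ θ' x'.2 y u) θ k *
          M.q x.1 u x'.1) (θ k) :=
      HasDerivAt.fun_sum fun y _ => HasDerivAt.fun_sum fun u _ =>
        ((hμ θ k x'.2 y u).hasDerivAt.const_mul _).mul_const _
    refine h.deriv.trans (Finset.sum_congr rfl fun y _ => Finset.sum_congr rfl fun u _ => ?_)
    conv_lhs => rw [← mul_div_of_abs_le_mul (hD θ k x'.2 y u)]
    simp only [weight, score, Sum.elim_inl, Transition.target, Transition.obs, Transition.action]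
    ring
  · have h : HasDerivAt (fun s => P M C θ (Function.update φ l s) x x')
        (∑ y, ∑ u, M.ν x.1 y * pderiv (fun φ' => C.ω φ' x.2 y x'.2) φ l * C.μ θ x'.2 y u *
          M.q x.1 u x'.1) (φ l) :=
      HasDerivAt.fun_sum fun y _ => HasDerivAt.fun_sum fun u _ =>
        (((hω φ l x.2 y x'.2).hasDerivAt.const_mul _).mul_const _).mul_const _
    refine h.deriv.trans (Finset.sum_congr rfl fun y _ => Finset.sum_congr rfl fun u _ => ?_)
    conv_lhs => rw [← mul_div_of_abs_le_mul (hB φ l x.2 y x'.2)]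
    simp only [weight, score, Sum.elim_inr, Transition.target, Transition.obs, Transition.source]
    ring

end Gradient

/-! ### Convergence of the estimate -/

section Averages

variable {S U Y G : Type*} [Fintype S] [Fintype U] [Fintype Y] [Fintype G] {nθ nφ : ℕ}
  [MeasurableSpace S] [MeasurableSpace U] [MeasurableSpace Y] [MeasurableSpace G]
  [MeasurableSingletonClass S] [MeasurableSingletonClass G]
  {M : POMDP S U Y} {C : Controller G U Y nθ nφ} {θ : Fin nθ → ℝ} {φ : Fin nφ → ℝ}

/-- The average over a fresh transition of a function that is affine in the reward. -/
theorem integral_stepLaw_affine (hM : ∀ i, Integrable (fun ρ => ρ) (M.rewardLaw i))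
    {c : Transition S U Y G → ℝ} (hc : Measurable c)
    (hcρ : ∀ x y u x' ρ, c (x, y, u, x', ρ) = c (x, y, u, x', 0)) (a b : S × G → ℝ) (x : S × G) :
    ∫ e, (c e * (e.reward + a e.target) + b e.target) ∂(stepLaw M C θ φ x) =
      ∑ x', (∑ y, ∑ u, weight M C θ φ x y u x' * c (x, y, u, x', 0)) * (M.r x'.1 + a x') +
        (P M C θ φ *ᵥ b) x := by
  have ha : Measurable (fun e : Transition S U Y G => a e.target) :=
    (Measurable.of_discrete (f := a)).comp measurable_target
  have hb : Measurable (fun e : Transition S U Y G => b e.target) :=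
    (Measurable.of_discrete (f := b)).comp measurable_target
  have hi : ∀ y u (x' : S × G), Integrable
      (fun ρ => c (x, y, u, x', 0) * (ρ + a x')) (M.rewardLaw x'.1) := fun y u x' =>
    ((hM x'.1).add (integrable_const _)).const_mul _
  have hval : ∀ y u (x' : S × G), ∫ ρ, (c (x, y, u, x', 0) * (ρ + a x') + b x')
      ∂(M.rewardLaw x'.1) = c (x, y, u, x', 0) * (M.r x'.1 + a x') + b x' := by
    intro y u x'
    rw [integral_add (hi y u x') (integrable_const _), integral_const_mul,
      integral_add (hM x'.1) (integrable_const _)]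
    simp [POMDP.r]
  have hmeas : Measurable (fun e : Transition S U Y G =>
      c e * (e.reward + a e.target) + b e.target) := (hc.mul (measurable_reward.add ha)).add hb
  rw [integral_stepLaw M C θ φ hmeas
    (by
      intro y u x'
      simp only [hcρ x y u x', Transition.reward, Transition.target]
      exact (hi y u x').add (integrable_const _))]
  simp only [hcρ x, Transition.reward, Transition.target, hval, Matrix.mulVec, dotProduct,
    P_apply, Finset.sum_mul, ← Finset.sum_add_distrib]
  refine Finset.sum_congr rfl fun x' _ => Finset.sum_congr rfl fun y _ =>
    Finset.sum_congr rfl fun u _ => ?_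
  ring

variable [MeasurableSingletonClass U] [MeasurableSingletonClass Y]

theorem measurable_score (k : Fin nθ ⊕ Fin nφ) :
    Measurable (fun e : Transition S U Y G => score C θ φ e k) := by
  have h : Measurable (fun w : (S × G) × Y × U × (S × G) =>
      score C θ φ (w.1, w.2.1, w.2.2.1, w.2.2.2, 0) k) := Measurable.of_discrete
  exact h.comp (f := fun e : Transition S U Y G => (e.1, e.2.1, e.2.2.1, e.2.2.2.1)) (by fun_prop)

/-- The trace `z_{t+1}` is determined by the transitions up to time `t`. -/
theorem measurable_elig {β : ℝ} (k : Fin nθ ⊕ Fin nφ) (t : ℕ) :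
    Measurable[history S U Y G t] (fun X => elig C θ φ β X (t + 1) k) := by
  induction t with
  | zero =>
    exact (measurable_const (a := β * 0)).add
      ((measurable_score k).comp (measurable_history_coord le_rfl))
  | succ t ih =>
    exact ((ih.mono (history_mono t.le_succ) le_rfl).const_mul β).add
      ((measurable_score k).comp (measurable_history_coord le_rfl))

/-- Reduction of the estimate to a strong law: the increments of the average differ from their
limit by a centred increment and a bounded telescoping term. -/
theorem ae_tendsto_estimate {R D B β : ℝ} (hR : ∀ i, ∀ᵐ ρ ∂(M.rewardLaw i), |ρ| ≤ R)
    (hμ : ∀ θ k h y u, HasPartialAt (fun θ' => C.μ θ' h y u) θ k)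
    (hω : ∀ φ l g y h, HasPartialAt (fun φ' => C.ω φ' g y h) φ l)
    (hD : ∀ θ k h y u, |pderiv (fun θ' => C.μ θ' h y u) θ k| ≤ D * C.μ θ h y u)
    (hB : ∀ φ l g y h, |pderiv (fun φ' => C.ω φ' g y h) φ l| ≤ B * C.ω φ g y h)
    (hβ0 : 0 ≤ β) (hβ1 : β < 1) {p : S × G → ℝ} (hp : IsStationary (P M C θ φ) p)
    (hunique : ∀ v, IsStationary (P M C θ φ) v → v = p)
    (init : Measure (S × G)) [IsProbabilityMeasure init] (k : Fin nθ ⊕ Fin nφ) :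
    ∀ᵐ X ∂(runLaw M C θ φ init), Tendsto (fun T : ℕ => estimate C θ φ β X T k) atTop
      (𝓝 ((p ᵥ* gradP M C θ φ k) ⬝ᵥ J M C θ φ β)) := by
  set η := (p ᵥ* gradP M C θ φ k) ⬝ᵥ J M C θ φ β with hη
  obtain ⟨b, hb⟩ := exists_poisson (P_nonneg M C θ φ) (P_rowSum M C θ φ) hp hunique
    (gradP M C θ φ k *ᵥ J M C θ φ β)
  rw [Matrix.dotProduct_mulVec, ← hη] at hb
  set K := max |D| |B|
  have hK : ∀ e : Transition S U Y G, |score C θ φ e k| ≤ K := fun e =>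
    abs_score_le θ φ hD hB e k
  set Z := K / (1 - β)
  have hZ : ∀ X t, |elig C θ φ β X t k| ≤ Z := fun X t =>
    abs_elig_le hβ0 hβ1 (fun e : Transition S U Y G => hK e) X t
  set a : S × G → ℝ := fun x => J M C θ φ β x - M.r x.1 with ha
  have hM : ∀ i, Integrable (fun ρ => ρ) (M.rewardLaw i) := fun i =>
    Integrable.of_bound measurable_id.aestronglyMeasurable R (hR i)
  have hra : ∀ x, M.r x.1 + a x = J M C θ φ β x := fun x => by simp [ha]
  -- With `z' = β z + score`, the quantity `r' z' + w(x', z')` is `β z f₁ + f₂`.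
  set f₁ : Transition S U Y G → ℝ := fun e => e.reward + a e.target with hf₁
  set f₂ : Transition S U Y G → ℝ :=
    fun e => score C θ φ e k * (e.reward + a e.target) + b e.target with hf₂
  have hE₁ : ∀ x, β * ∫ e, f₁ e ∂(stepLaw M C θ φ x) = a x := by
    intro x
    have h := integral_stepLaw_affine (M := M) (C := C) (θ := θ) (φ := φ) hM
      (c := fun _ => 1) measurable_const (fun _ _ _ _ _ => rfl) a (fun _ => 0) x
    simp only [one_mul, add_zero, hra, mul_one, ← P_apply] at h
    rw [hf₁, h]
    have hJ := J_eq M C θ φ hβ0 hβ1 x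
    simp only [Matrix.mulVec, dotProduct, mul_zero, Finset.sum_const_zero, add_zero, ha] at hJ ⊢
    linarith
  have hE₂ : ∀ x, ∫ e, f₂ e ∂(stepLaw M C θ φ x) = b x + η := by
    intro x
    have h := integral_stepLaw_affine (M := M) (C := C) (θ := θ) (φ := φ) hM
      (c := fun e => score C θ φ e k) (measurable_score k) (fun _ _ _ _ _ => rfl) a b x
    rw [hf₂, h]
    simp only [hra, ← gradP_apply M θ φ hμ hω hD hB k]
    have := hb x
    simp only [Matrix.mulVec, dotProduct] at this ⊢
    linarith
  obtain ⟨La, hLa⟩ := Set.Finite.bddAbove (Set.finite_range fun x => |a x|)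
  obtain ⟨Lb, hLb⟩ := Set.Finite.bddAbove (Set.finite_range fun x => |b x|)
  have hLa' : ∀ x, |a x| ≤ La := fun x => hLa ⟨x, rfl⟩
  have hLb' : ∀ x, |b x| ≤ Lb := fun x => hLb ⟨x, rfl⟩
  have hmt : ∀ g : S × G → ℝ, Measurable (fun e : Transition S U Y G => g e.target) := fun g =>
    (Measurable.of_discrete (f := g)).comp measurable_target
  have hm₁ : Measurable f₁ :=
    measurable_reward.add (hmt a)
  have hm₂ : Measurable f₂ :=
    ((measurable_score k).mul (measurable_reward.add (hmt a))).add (hmt b)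
  have hrew : ∀ x, ∀ᵐ e ∂(stepLaw M C θ φ x), |e.reward| ≤ R := fun x =>
    ae_stepLaw M C θ φ (measurableSet_le measurable_reward.abs measurable_const)
      fun _ _ x' => hR x'.1
  have hb₁ : ∀ x, ∀ᵐ e ∂(stepLaw M C θ φ x), |f₁ e| ≤ R + La := by
    intro x
    filter_upwards [hrew x] with e he
    exact (abs_add_le _ _).trans (add_le_add he (hLa' _))
  have hb₂ : ∀ x, ∀ᵐ e ∂(stepLaw M C θ φ x), |f₂ e| ≤ K * (R + La) + Lb := by
    intro x
    filter_upwards [hrew x] with e he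
    refine (abs_add_le _ _).trans (add_le_add ?_ (hLb' _))
    rw [abs_mul]
    exact mul_le_mul (hK e) ((abs_add_le _ _).trans (add_le_add he (hLa' _))) (abs_nonneg _)
      ((abs_nonneg _).trans (hK e))
  have hA₁ : ∀ (X : ℕ → Transition S U Y G) t, |β * elig C θ φ β X (t + 1) k| ≤ β * Z := by
    intro X t
    rw [abs_mul, abs_of_nonneg hβ0]
    exact mul_le_mul_of_nonneg_left (hZ X _) hβ0
  filter_upwards [ae_tendsto_avg_increments M C θ φ init
      (A := fun t X => β * elig C θ φ β X (t + 1) k)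
      (fun t => (measurable_elig k t).const_mul β) (fun t X => hA₁ X t) hm₁ hb₁,
    ae_tendsto_avg_increments M C θ φ init (A := fun _ _ => 1) (fun _ => measurable_const)
      (c := 1) (fun _ _ => by simp) hm₂ hb₂] with X h₁ h₂
  set z : ℕ → ℝ := fun t => elig C θ φ β X t k
  set w : ℕ → ℝ := fun t => z (t + 1) * a (X t).target + b (X t).target with hw
  have hwb : ∀ t, |w t| ≤ Z * La + Lb := by
    intro t
    refine (abs_add_le _ _).trans (add_le_add ?_ (hLb' _))
    rw [abs_mul]
    exact mul_le_mul (hZ X _) (hLa' _) (abs_nonneg _) ((abs_nonneg _).trans (hZ X 0))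
  set s₁ : ℕ → ℝ := fun t => β * z (t + 1) *
    (f₁ (X (t + 1)) - ∫ e, f₁ e ∂(stepLaw M C θ φ (X t).target)) with hs₁
  set s₂ : ℕ → ℝ := fun t => 1 *
    (f₂ (X (t + 1)) - ∫ e, f₂ e ∂(stepLaw M C θ φ (X t).target)) with hs₂
  have hstep : ∀ t, (X (t + 1)).reward * z (t + 2) = η + s₁ t + s₂ t + (w t - w (t + 1)) := by
    intro t
    have hz : z (t + 2) = β * z (t + 1) + score C θ φ (X (t + 1)) k := rfl
    simp only [hs₁, hs₂, hw, hE₂, mul_sub]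
    have := hE₁ (X t).target
    rw [mul_right_comm β (z (t + 1)) (∫ e, f₁ e ∂(stepLaw M C θ φ (X t).target)), this,
      show t + 1 + 1 = t + 2 from rfl, hz, hf₁, hf₂]
    ring
  -- The first term of the average is split off: no transition precedes it, so it is not centred.
  have hsum : ∀ n : ℕ, ∑ t ∈ Finset.range (n + 1), (X t).reward * z (t + 1) =
      n * η + ∑ t ∈ Finset.range n, s₁ t + ∑ t ∈ Finset.range n, s₂ t +
        ((X 0).reward * z 1 + w 0 - w n) := by
    intro n
    rw [Finset.sum_range_succ']
    simp only [show ∀ t, t + 1 + 1 = t + 2 from fun _ => rfl, hstep, Finset.sum_add_distrib,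
      Finset.sum_range_sub', Finset.sum_const, Finset.card_range, nsmul_eq_mul]
    ring
  have hrest : Tendsto (fun n : ℕ => ((X 0).reward * z 1 + w 0 - w n) / (n : ℝ)) atTop
      (𝓝 0) := by
    refine squeeze_zero_norm (a := fun n : ℕ =>
      (|(X 0).reward * z 1 + w 0| + (Z * La + Lb)) / (n : ℝ)) (fun n => ?_)
      (tendsto_const_div_atTop_nhds_zero_nat _)
    rw [Real.norm_eq_abs, abs_div, Nat.abs_cast]
    gcongr
    exact (abs_sub _ _).trans (add_le_add le_rfl (hwb n))
  have hn : Tendsto (fun n : ℕ => (n : ℝ) / ((n : ℝ) + 1)) atTop (𝓝 1) :=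
    tendsto_natCast_div_add_atTop 1
  have hlim := (((h₁.add h₂).add hrest).const_add η).mul hn
  rw [← tendsto_add_atTop_iff_nat 1]
  simp only [add_zero, mul_one] at hlim
  refine hlim.congr' ?_
  filter_upwards [eventually_gt_atTop 0] with n hn0
  have hn0' : (n : ℝ) ≠ 0 := by exact_mod_cast hn0.ne'
  have hn1 : (n : ℝ) + 1 ≠ 0 := by positivity
  rw [estimate_eq, hsum n]
  push_cast
  field_simp
  ring

end Averages

end IStatePOMDP

end

open IStatePOMDP in
theorem theorem2 {S U Y G : Type*}
    [Fintype S] [Fintype U] [Fintype Y] [Fintype G]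
    [MeasurableSpace S] [MeasurableSingletonClass S]
    [MeasurableSpace U] [MeasurableSingletonClass U]
    [MeasurableSpace Y] [MeasurableSingletonClass Y]
    [MeasurableSpace G] [MeasurableSingletonClass G]
    {nθ nφ : ℕ}
    (M : POMDP S U Y) (C : Controller G U Y nθ nφ)
    -- every `P(θ,φ)` has a unique stationary distribution
    (hstat : ∀ θ φ, ∃! p : S × G → ℝ, IsStationary (P M C θ φ) p)
    -- the rewards are uniformly bounded
    (hreward : ∃ R : ℝ, ∀ i, ∀ᵐ x ∂(M.rewardLaw i), |x| ≤ R)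
    -- the partial derivatives exist and are uniformly bounded
    (hderivμ : ∃ K : ℝ, ∀ θ k h y u, HasPartialAt (fun θ' => C.μ θ' h y u) θ k ∧
      |pderiv (fun θ' => C.μ θ' h y u) θ k| ≤ K)
    (hderivω : ∃ Q : ℝ, ∀ φ l g y h, HasPartialAt (fun φ' => C.ω φ' g y h) φ l ∧
      |pderiv (fun φ' => C.ω φ' g y h) φ l| ≤ Q)
    -- their ratios to the probabilities are uniformly bounded
    (hratioμ : ∃ D : ℝ, ∀ θ k h y u,
      |pderiv (fun θ' => C.μ θ' h y u) θ k| ≤ D * C.μ θ h y u)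
    (hratioω : ∃ B : ℝ, ∀ φ l g y h,
      |pderiv (fun φ' => C.ω φ' g y h) φ l| ≤ B * C.ω φ g y h)
    (β : ℝ) (hβ0 : 0 ≤ β) (hβ1 : β < 1)
    (θ : Fin nθ → ℝ) (φ : Fin nφ → ℝ)
    (p : S × G → ℝ) (hp : IsStationary (P M C θ φ) p)
    (init : Measure (S × G)) [IsProbabilityMeasure init] :
    ∀ᵐ X ∂(runLaw M C θ φ init),
      Tendsto (fun T : ℕ => estimate C θ φ β X T) atTop
        (𝓝 (fun k => (p ᵥ* gradP M C θ φ k) ⬝ᵥ J M C θ φ β)) := by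
  obtain ⟨R, hR⟩ := hreward
  obtain ⟨K, hK⟩ := hderivμ
  obtain ⟨Q, hQ⟩ := hderivω
  obtain ⟨D, hD⟩ := hratioμ
  obtain ⟨B, hB⟩ := hratioω
  have hunique : ∀ v, IsStationary (P M C θ φ) v → v = p := fun v hv => (hstat θ φ).unique hv hp
  filter_upwards [ae_all_iff.2 fun k => ae_tendsto_estimate hR
    (fun θ k h y u => (hK θ k h y u).1) (fun φ l g y h => (hQ φ l g y h).1) hD hB hβ0 hβ1 hp
    hunique init k] with X hX
  exact tendsto_pi_nhds.2 hX
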